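/- Let $d,M\ge 1$ be integers. For a weight vector $w\in\mathbb{R}^d$ put $d_w^{l_1}(o,q)=\sum_{i=1}^d w_i|o_i-q_i|$ for $o,q\in\{0,\dots,M\}^d$ (the weights are arbitrary reals and are supplied together with the query). Fix a bucket width $W>0$ and let $h(x)=\lfloor (a^{T}x+b)/W\rfloor$ with $a$ having independent standard normal coordinates and $b$ independent and uniform on $[0,W]$; let $P^{l_2}(r)=1-2\Phi(-W/r)-\frac{2}{\sqrt{2\pi}\,(W/r)}\bigl(1-e^{-W^2/(2r^2)}\bigr)$ for $r>0$ and $P^{l_2}(0)=1$ be its collision probability at Euclidean distance $r$. Let $v(x)\in\{0,1\}^{Md}$ be the unary coding of $x\in\{0,\dots,M\}^d$ (block $i$ is $x_i$ ones followed by $M-x_i$ zeros), let $P(x)\in\mathbb{R}^{2Md}$ consist of the numbers $\cos(\frac{\pi}{2}v(x)_{ij})$ followed by the numbers $\sin(\frac{\pi}{2}v(x)_{ij})$, and let $Q_w(x)$ consist of the same numbers multiplied by $w_i$. The scheme $(d_w^{l_1},l_2)$-ALSH uses the hash functions $f=h\circ P$ for data points and $g=h\circ Q_w$ for query points: it keeps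 $L$ tables of the $n$ data points, where the bucket of a point in a table is given by $K$ values of $f$ and all $KL$ functions $h$ are independent; a query examines in turn the data points in the bucket, given by the corresponding values of $g$, that it meets in each table, returns the first one found within distance $R_2$, and gives up after $T$ candidates. Let $R_1<R_2$ with $M(d+\sum_i w_i^2)-2(M\sum_i w_i-R_1)\ge 0$, and put $$P(r)=P^{l_2}\Bigl(\sqrt{M(d+\textstyle\sum_i w_i^2)-2(M\sum_i w_i-r)}\Bigr),\qquad p_1=P(R_1),\quad p_2=P(R_2),\quad \rho=\frac{\log p_1}{\log p_2}.$$ Then $0<p_2<p_1\le 1$ and $\rho<1$. Moreover, for every $\delta\in(0,1)$ the parameters $K,L,T$ can be chosen as functions of $n,p_1,p_2,\delta$ such that, with a constant $C$ depending only on $p_1,p_2,\delta$, the following holds on a unit-cost real RAM for all $n\ge 2$ and all families of $n$ (not necessarily distinct) data points in $\{0,\dots,M\}^d$. For every query $q\in\{0,\dots,M\}^d$, with probability at least $1-\delta$ the scheme solves $(R_1,R_2)$-NNS: if some data point $o'$ has $d_w^{l_1}(o',q)\le R_1$, it returns a data point $o$ with $d_w^{l_1}(o,q)\le R_2$. The query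 time is always at most $C\,n^{\rho}d\log n$. The hash tables take at most $C\,n^{1+\rho}$ memory cells, and the whole data structure, including the data points and the hash functions, takes at most $C\,dM\,n^{1+\rho}$ memory cells, that is, $O(n^{1+\rho})$ for fixed $d$ and $M$. -/

import Mathlib

open MeasureTheory ProbabilityTheory
open scoped ENNReal

noncomputable section

namespace ALSH

/-! ### Points, weighted Manhattan distance, near neighbor search -/

/-- The point set `{0, 1, …, M}^d`. -/
abbrev Point (d M : ℕ) : Type := Fin d → Fin (M + 1)

/-- The generalized weighted Manhattan distance `∑ i, w i * |o i - q i|`. -/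
def wdist {d M : ℕ} (w : Fin d → ℝ) (o q : Point d M) : ℝ :=
  ∑ i, w i * |((o i : ℕ) : ℝ) - ((q i : ℕ) : ℝ)|

/-- `out` is a correct answer to the `(R₁, R₂)`-near neighbor query `q` on the data points `D`:
if some data point is within distance `R₁` of `q`, then `out` names a data point within
distance `R₂` of `q`. -/
def IsNNSAnswer {X Y : Type} {n : ℕ} (dist : X → Y → ℝ) (R₁ R₂ : ℝ) (D : Fin n → X) (q : Y)
    (out : Option (Fin n)) : Prop :=
  (∃ i, dist (D i) q ≤ R₁) → ∃ i, out = some i ∧ dist (D i) q ≤ R₂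

/-! ### The E2LSH family for the Euclidean distance -/

/-- The hash function `x ↦ ⌊(aᵀ x + b) / W⌋` with bucket width `W`. -/
def hashL2 {ι : Type} [Fintype ι] (W : ℝ) (ab : (ι → ℝ) × ℝ) (x : ι → ℝ) : ℤ :=
  ⌊((∑ i, ab.1 i * x i) + ab.2) / W⌋

/-- The law of `(a, b)`: the coordinates of `a` are independent standard normal variables and `b`
is independent of them and uniform on `[0, W]`. -/
def lawL2 (ι : Type) [Fintype ι] (W : ℝ) : Measure ((ι → ℝ) × ℝ) :=
  (Measure.pi fun _ : ι => gaussianReal 0 1).prod (cond volume (Set.Icc 0 W))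

/-- The collision probability of `hashL2` for two points at Euclidean distance `r`; at `r = 0`,
where the closed formula is undefined, it is `1`, the collision probability of equal points. -/
def collL2 (W r : ℝ) : ℝ :=
  if r = 0 then 1
  else 1 - 2 * cdf (gaussianReal 0 1) (-(W / r))
    - 2 / (√(2 * Real.pi) * (W / r)) * (1 - Real.exp (-(W ^ 2 / (2 * r ^ 2))))

/-! ### The transformations and the asymmetric family -/

/-- Coordinates of the transformed space `ℝ^(2Md)`: a block of `Md` cosines followed by a block
of `Md` sines. -/
abbrev Coord (d M : ℕ) : Type := (Fin d × Fin M) ⊕ (Fin d × Fin M)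

/-- The unary coding `v(x)`: its `i`-th block is `x i` ones followed by `M - x i` zeros. -/
def unary {d M : ℕ} (x : Point d M) (ij : Fin d × Fin M) : ℝ :=
  if (ij.2 : ℕ) < (x ij.1 : ℕ) then 1 else 0

/-- The preprocessing transformation `P`. -/
def preTrans {d M : ℕ} (x : Point d M) : Coord d M → ℝ :=
  Sum.elim (fun ij => Real.cos (Real.pi / 2 * unary x ij))
    (fun ij => Real.sin (Real.pi / 2 * unary x ij))

/-- The query transformation `Q_w`. -/
def queryTrans {d M : ℕ} (w : Fin d → ℝ) (x : Point d M) : Coord d M → ℝ :=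
  Sum.elim (fun ij => w ij.1 * Real.cos (Real.pi / 2 * unary x ij))
    (fun ij => w ij.1 * Real.sin (Real.pi / 2 * unary x ij))

/-- The hash function `f = h ∘ P` for data points. -/
def hashData {d M : ℕ} (W : ℝ) (ab : (Coord d M → ℝ) × ℝ) (o : Point d M) : ℤ :=
  hashL2 W ab (preTrans o)

/-- The hash function `g = h ∘ Q_w` for query points. -/
def hashQuery {d M : ℕ} (W : ℝ) (ab : (Coord d M → ℝ) × ℝ) (w : Fin d → ℝ) (q : Point d M) : ℤ :=
  hashL2 W ab (queryTrans w q)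

/-- The square of the Euclidean distance of `P(o)` and `Q_w(q)` when `wdist w o q = r`. -/
def transDistSq (d M : ℕ) (w : Fin d → ℝ) (r : ℝ) : ℝ :=
  M * (d + ∑ i, w i ^ 2) - 2 * (M * ∑ i, w i - r)

/-- The collision probability of the asymmetric family at weighted Manhattan distance `r`. -/
def collProb (d M : ℕ) (W : ℝ) (w : Fin d → ℝ) (r : ℝ) : ℝ :=
  collL2 W √(transDistSq d M w r)

/-! ### Step counting: unit-cost real random access machine -/

/-- A result together with the number of elementary steps spent to obtain it. -/
structure Timed (α : Type) where
  val : α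
  steps : ℕ

instance : Monad Timed where
  pure a := ⟨a, 0⟩
  bind x f := ⟨(f x.val).val, x.steps + (f x.val).steps⟩

/-- One elementary operation (a memory access, an arithmetic operation, or a floor) with
result `a`. -/
def op {α : Type} (a : α) : Timed α := ⟨a, 1⟩

/-- `k` steps of control flow (tests and jumps). -/
def tick (k : ℕ) : Timed Unit := ⟨(), k⟩

/-- A loop that adds up `term i` for `i` in a list. -/
def sumLoop {ι : Type} (term : ι → Timed ℝ) : List ι → Timed ℝ
  | [] => op 0
  | i :: l => do
      tick 1
      let t ← term i
      let s ← sumLoop term l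
      op (t + s)

/-! ### The data structure -/

/-- The memory content of the data structure: `n` data points and `L` tables of `n` entries, whose
buckets are given by `K` hash functions each. A table is an array of data point numbers, sorted by
the label of the bucket that the point lies in. The vector `a` of a hash function is stored through
partial sums of its blocks. -/
structure Index (n d M K L : ℕ) where
  width : ℝ
  cutoff : ℕ
  coeff : Fin K → ℝ
  point : Fin n → Fin d → Fin (M + 1)
  cosSum : Fin L → Fin K → Fin d → Fin (M + 1) → ℝ
  sinSum : Fin L → Fin K → Fin d → Fin (M + 1) → ℝ
  offset : Fin L → Fin K → ℝ
  label : Fin L → Fin n → ℝ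
  member : Fin L → Fin n → Fin n

/-- Number of memory cells used by the tables (`label` and `member`). -/
def tableSpace (n L : ℕ) : ℕ := 2 * (L * n)

/-- Number of memory cells of the whole data structure, data points and hash functions included
(one cell for every number in an `Index`, and one for each of `n`, `d`, `K`, `L`). -/
def totalSpace (n d M K L : ℕ) : ℕ :=
  6 + K + n * d + 2 * (L * K * d * (M + 1)) + L * K + tableSpace n L

/-- The random choices: parameters `(a, b)` of `L * K` hash functions. -/
abbrev Seed (d M K L : ℕ) : Type := Fin L × Fin K → (Coord d M → ℝ) × ℝ

/-- The `L * K` hash functions are drawn independently. -/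
def seedLaw (d M K L : ℕ) (W : ℝ) : Measure (Seed d M K L) :=
  Measure.pi fun _ => lawL2 (Coord d M) W

/-- The bucket of a data point `o` in table `j` is the vector of its `K` hash values; its label is
the linear combination of them with coefficients `c`. -/
def dataLabel {d M K L : ℕ} (W : ℝ) (c : ℕ → ℝ) (ω : Seed d M K L) (j : Fin L) (o : Point d M) :
    ℝ :=
  ∑ k : Fin K, c k * (hashData W (ω (j, k)) o : ℝ)

/-- The data structure built from the data points `D`; no query and no weights are involved. -/
def build {n d M K L : ℕ} (W : ℝ) (c : ℕ → ℝ) (T : ℕ) (ω : Seed d M K L) (D : Fin n → Point d M) :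
    Index n d M K L where
  width := W
  cutoff := T
  coeff k := c k
  point := D
  cosSum j k i x := ∑ m : Fin M, if (m : ℕ) < (x : ℕ) then 0 else (ω (j, k)).1 (.inl (i, m))
  sinSum j k i x := ∑ m : Fin M, if (m : ℕ) < (x : ℕ) then (ω (j, k)).1 (.inr (i, m)) else 0
  offset j k := (ω (j, k)).2
  label j p := dataLabel W c ω j (D (Tuple.sort (fun i => dataLabel W c ω j (D i)) p))
  member j p := Tuple.sort (fun i => dataLabel W c ω j (D i)) p

/-! ### The query algorithm -/

variable {n d M K L : ℕ}

/-- The value of the `k`-th hash function of table `j` at the query `q` with weights `w`. -/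
def queryHash (S : Index n d M K L) (w : Fin d → ℝ) (q : Point d M) (j : Fin L) (k : Fin K) :
    Timed ℤ := do
  let s ← sumLoop (fun i => do
    let x ← op (q i)
    let u ← op (S.cosSum j k i x)
    let v ← op (S.sinSum j k i x)
    let y ← op (u + v)
    let z ← op (w i)
    op (z * y)) (List.finRange d)
  let b ← op (S.offset j k)
  let t ← op (s + b)
  let W ← op S.width
  let y ← op (t / W)
  op ⌊y⌋

/-- The label of the bucket of the query in table `j`. -/
def queryLabel (S : Index n d M K L) (w : Fin d → ℝ) (q : Point d M) (j : Fin L) : Timed ℝ :=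
  sumLoop (fun k => do
    let h ← queryHash S w q j k
    let r ← op (S.coeff k)
    op (r * (h : ℝ))) (List.finRange K)

/-- The weighted Manhattan distance of data point number `i` to the query. -/
def queryDist (S : Index n d M K L) (w : Fin d → ℝ) (q : Point d M) (i : Fin n) : Timed ℝ :=
  sumLoop (fun m => do
    let x ← op (S.point i m)
    let y ← op (q m)
    let t ← op (((x : ℕ) : ℝ) - ((y : ℕ) : ℝ))
    let u ← op |t|
    let z ← op (w m)
    op (z * u)) (List.finRange d)

/-- Binary search in positions `lo ≤ p < hi` of a sorted array for the first entry `≥ x`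
(`hi` if there is none). A round tests `lo < hi`, computes the middle position in two operations,
reads one entry, compares it with `x` and updates a bound. -/
def lowerBound (A : Fin n → ℝ) (x : ℝ) (lo hi : ℕ) (hhi : hi ≤ n) : Timed ℕ :=
  if h : lo < hi then do
    tick 6
    if A ⟨(lo + hi) / 2, by omega⟩ < x then lowerBound A x ((lo + hi) / 2 + 1) hi hhi
    else lowerBound A x lo ((lo + hi) / 2) (by omega)
  else do
    tick 1
    pure lo
termination_by hi - lo

/-- Examine the entries of table `j` from position `p` on, as long as they have label `x`, until a
point within distance `R` of the query is found or the given number of candidates is used up.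
Returns the number of candidates left and the point found. -/
def scan (S : Index n d M K L) (w : Fin d → ℝ) (q : Point d M) (R : ℝ) (j : Fin L) (x : ℝ) :
    ℕ → ℕ → Timed (ℕ × Option (Fin n))
  | 0, _ => do
      tick 1
      pure (0, none)
  | T + 1, p => do
      tick 2
      if h : p < n then do
        let y ← op (S.label j ⟨p, h⟩)
        tick 1
        if y = x then do
          let i ← op (S.member j ⟨p, h⟩)
          let r ← queryDist S w q i
          tick 1
          if r ≤ R then pure (T, some i)
          else do
            tick 2
            scan S w q R j x T (p + 1)
        else pure (T + 1, none)
      else pure (T + 1, none)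

/-- Search the tables in a list one after the other, examining at most the given number of
candidates altogether. -/
def searchTables (S : Index n d M K L) (w : Fin d → ℝ) (q : Point d M) (R : ℝ) :
    List (Fin L) → ℕ → Timed (Option (Fin n))
  | [], _ => do
      tick 1
      pure none
  | j :: l, T => do
      tick 1
      let x ← queryLabel S w q j
      let p ← lowerBound (S.label j) x 0 n le_rfl
      let res ← scan S w q R j x T p
      tick 2
      match res.2 with
      | some i => pure (some i)
      | none => if res.1 = 0 then pure none else searchTables S w q R l res.1

/-- The query algorithm: search all `L` tables for a point within distance `R`, and give up after
`S.cutoff` candidates. -/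
def query (S : Index n d M K L) (w : Fin d → ℝ) (q : Point d M) (R : ℝ) :
    Timed (Option (Fin n)) := do
  let T ← op S.cutoff
  searchTables S w q R (List.finRange L) T

/-! ### The query algorithm computes the asymmetric family -/

theorem sumLoop_val {ι : Type} (term : ι → Timed ℝ) (l : List ι) :
    (sumLoop term l).val = (l.map fun i => (term i).val).sum := by
  induction l with
  | nil => rfl
  | cons i l ih => rw [List.map_cons, List.sum_cons, ← ih]; rfl

/-- The hash values computed by the query algorithm are those of `g = h ∘ Q_w`. -/
theorem queryHash_build (W : ℝ) (c : ℕ → ℝ) (T : ℕ) (ω : Seed d M K L) (D : Fin n → Point d M)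
    (w : Fin d → ℝ) (q : Point d M) (j : Fin L) (k : Fin K) :
    (queryHash (build W c T ω D) w q j k).val = hashQuery W (ω (j, k)) w q := by
  have e : (queryHash (build W c T ω D) w q j k).val
      = ⌊((sumLoop (fun i => (⟨w i * ((build W c T ω D).cosSum j k i (q i)
        + (build W c T ω D).sinSum j k i (q i)), 0⟩ : Timed ℝ)) (List.finRange d)).val
        + (ω (j, k)).2) / W⌋ := by
    rw [sumLoop_val]
    change ⌊((sumLoop _ _).val + (ω (j, k)).2) / W⌋ = _
    rw [sumLoop_val]
    rfl
  rw [e, sumLoop_val, hashQuery, hashL2]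
  have hs : ∀ F : Fin d → ℝ, ((List.finRange d).map F).sum = ∑ i, F i := fun F => by
    rw [← List.ofFn_eq_map, List.sum_ofFn]
  rw [hs]
  congr 3
  rw [Fintype.sum_sum_type, Fintype.sum_prod_type, Fintype.sum_prod_type,
    ← Finset.sum_add_distrib]
  refine Finset.sum_congr rfl fun i _ => ?_
  rw [← Finset.sum_add_distrib]
  simp only [build]
  rw [← Finset.sum_add_distrib, Finset.mul_sum]
  refine Finset.sum_congr rfl fun m _ => ?_
  by_cases hm : (m : ℕ) < (q i : ℕ)
  · simp [queryTrans, unary, hm, mul_comm]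
  · simp [queryTrans, unary, hm, mul_comm]

end ALSH

end

/-!
# Weighted Manhattan near neighbors by asymmetric hashing

Two coordinates of the unary codes that agree contribute `(1 - w i) ^ 2` to the squared distance of
`P(o)` and `Q_w(q)`, and two that differ contribute `1 + w i ^ 2`; hence this squared distance is an
increasing affine function of the weighted Manhattan distance
(`sum_preTrans_sub_queryTrans_sq`), and everything reduces to the Euclidean hash family.

For fixed `a`, the random shift `b` keeps two projections at distance `s` in the same interval of
length `W` with probability `max 0 (1 - s / W)` (`cond_floor_eq`), and the difference of the
projections of two points at distance `r` is `r` times a standard normal variable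
(`map_pi_gaussianReal_sum`). So the collision probability is the Gaussian mean `meanTent` of
`max 0 (1 - |r * z| / W)`. In this form it is visibly positive, at most `1` and strictly decreasing
in `r`; `collL2_eq_meanTent` identifies it with the closed formula. This gives `0 < p₂ < p₁ ≤ 1`,
and `ρ < 1` follows.

The rest is the amplification argument of locality-sensitive hashing. With
`K = ⌈log n / log (1 / p₂)⌉` hash functions per table, a far point shares the bucket of the query
with probability at most `1 / n`, so the expected number of far candidates is at most `1` per table,
and Markov's inequality (`seedLaw_le_card_far`) bounds by `δ / 2` the probability of meeting
`T = ⌈2 * L / δ⌉` of them. A near point shares the bucket with probability at least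
`p₁ ^ K ≥ p₁ * n ^ (-ρ)`; the tables are independent (`pi_rows_apply`), so
`L = ⌈log (2 / δ) / p₁ ^ K⌉ = O(n ^ ρ)` tables all miss it with probability at most `δ / 2`. Outside
these two events the algorithm succeeds (`isNNSAnswer_query_build`): binary search finds the start
of the bucket in a sorted table, and a scan stops early only at a point within distance `R₂`.
Buckets are identified by their labels because the label coefficients are linearly independent over
`ℚ`. The running time, for every outcome of the random choices, is a count of steps
(`query_steps_le`), in which the cost of a scan is charged to the candidates that it uses up.
-/

noncomputable section

namespace ALSH

variable {n d M K L : ℕ}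

/-! ### Cost of the query algorithm -/

@[simp] theorem bind_val {α β : Type} (x : Timed α) (f : α → Timed β) :
    (x >>= f).val = (f x.val).val := rfl

@[simp] theorem bind_steps {α β : Type} (x : Timed α) (f : α → Timed β) :
    (x >>= f).steps = x.steps + (f x.val).steps := rfl

@[simp] theorem pure_val {α : Type} (a : α) : (pure a : Timed α).val = a := rfl

@[simp] theorem pure_steps {α : Type} (a : α) : (pure a : Timed α).steps = 0 := rfl

@[simp] theorem op_val {α : Type} (a : α) : (op a).val = a := rfl

@[simp] theorem op_steps {α : Type} (a : α) : (op a).steps = 1 := rfl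

@[simp] theorem tick_steps (k : ℕ) : (tick k).steps = k := rfl

theorem sumLoop_steps_le {ι : Type} (term : ι → Timed ℝ) (B : ℕ)
    (h : ∀ i, (term i).steps ≤ B) (l : List ι) :
    (sumLoop term l).steps ≤ (B + 2) * l.length + 1 := by
  induction l with
  | nil => simp [sumLoop]
  | cons i l ih =>
    have := h i
    simp only [sumLoop, bind_steps, tick_steps, op_steps, List.length_cons]
    rw [mul_add]
    omega

theorem queryHash_steps_le (S : Index n d M K L) (w : Fin d → ℝ) (q : Point d M) (j : Fin L)
    (k : Fin K) : (queryHash S w q j k).steps ≤ 8 * d + 6 := by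
  have := sumLoop_steps_le (fun i => do
    let x ← op (q i)
    let u ← op (S.cosSum j k i x)
    let v ← op (S.sinSum j k i x)
    let y ← op (u + v)
    let z ← op (w i)
    op (z * y)) 6 (fun i => by simp) (List.finRange d)
  rw [List.length_finRange] at this
  simp only [queryHash, bind_steps, op_steps] at this ⊢
  omega

theorem queryLabel_steps_le (S : Index n d M K L) (w : Fin d → ℝ) (q : Point d M) (j : Fin L) :
    (queryLabel S w q j).steps ≤ (8 * d + 10) * K + 1 := by
  have := sumLoop_steps_le (fun k => do
    let h ← queryHash S w q j k
    let r ← op (S.coeff k)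
    op (r * (h : ℝ))) (8 * d + 8) (fun k => by
      have := queryHash_steps_le S w q j k
      simp only [bind_steps, op_steps]
      omega) (List.finRange K)
  rwa [List.length_finRange] at this

theorem queryDist_steps_le (S : Index n d M K L) (w : Fin d → ℝ) (q : Point d M) (i : Fin n) :
    (queryDist S w q i).steps ≤ 8 * d + 1 := by
  have := sumLoop_steps_le (fun m => do
    let x ← op (S.point i m)
    let y ← op (q m)
    let t ← op (((x : ℕ) : ℝ) - ((y : ℕ) : ℝ))
    let u ← op |t|
    let z ← op (w m)
    op (z * u)) 6 (fun i => by simp) (List.finRange d)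
  rwa [List.length_finRange] at this

theorem lowerBound_steps_le (A : Fin n → ℝ) (x : ℝ) (m : ℕ) (lo hi : ℕ) (hhi : hi ≤ n)
    (hm : hi - lo < 2 ^ m) : (lowerBound A x lo hi hhi).steps ≤ 6 * m + 1 := by
  induction m generalizing lo hi with
  | zero =>
    have : ¬ lo < hi := by simp at hm; omega
    rw [lowerBound, dif_neg this]
    simp
  | succ m ih =>
    rw [lowerBound]
    rw [pow_succ] at hm
    split_ifs with h h'
    · have := ih ((lo + hi) / 2 + 1) hi hhi (by omega)
      simp only [bind_steps, tick_steps]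
      omega
    · have := ih lo ((lo + hi) / 2) (by omega) (by omega)
      simp only [bind_steps, tick_steps]
      omega
    · simp

/-- The cost of a scan, amortized over the candidates that it uses up. -/
theorem scan_steps_le (S : Index n d M K L) (w : Fin d → ℝ) (q : Point d M) (R : ℝ) (j : Fin L)
    (x : ℝ) (T p : ℕ) :
    (scan S w q R j x T p).val.1 ≤ T ∧
      (scan S w q R j x T p).steps + (8 * d + 9) * (scan S w q R j x T p).val.1
        ≤ (8 * d + 9) * T + 4 := by
  induction T generalizing p with
  | zero => simp [scan]
  | succ T ih =>
    by_cases h : p < n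
    · by_cases hy : S.label j ⟨p, h⟩ = x
      · have hd := queryDist_steps_le S w q (S.member j ⟨p, h⟩)
        by_cases hr : (queryDist S w q (S.member j ⟨p, h⟩)).val ≤ R
        · simp only [scan, h, hy, hr, bind_val, bind_steps, tick_steps, op_steps, op_val,
            dif_pos, if_pos, pure_val, pure_steps]
          rw [mul_add _ T]
          omega
        · have := ih (p + 1)
          simp only [scan, h, hy, hr, bind_val, bind_steps, tick_steps, op_steps, op_val,
            dif_pos, if_pos, if_false]
          rw [mul_add _ T]
          omega
      · simp only [scan, h, hy, bind_val, bind_steps, tick_steps, op_steps, op_val,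
            dif_pos, if_false, pure_val, pure_steps]
        omega
    · simp only [scan, h, bind_val, bind_steps, tick_steps, 
            dif_neg, not_false_eq_true, pure_val, pure_steps]
      omega

theorem searchTables_steps_le (S : Index n d M K L) (w : Fin d → ℝ) (q : Point d M) (R : ℝ)
    (m : ℕ) (hm : n < 2 ^ m) (l : List (Fin L)) (T : ℕ) :
    (searchTables S w q R l T).steps
      ≤ ((8 * d + 10) * K + 6 * m + 9) * l.length + (8 * d + 9) * T + 1 := by
  induction l generalizing T with
  | nil => simp [searchTables]
  | cons j l ih =>
    have h1 := queryLabel_steps_le S w q j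
    have h2 := lowerBound_steps_le (S.label j) (queryLabel S w q j).val m 0 n le_rfl (by simpa)
    obtain ⟨h3, h4⟩ := scan_steps_le S w q R j (queryLabel S w q j).val T
      (lowerBound (S.label j) (queryLabel S w q j).val 0 n le_rfl).val
    simp only [searchTables, bind_steps, tick_steps, List.length_cons]
    rw [mul_add _ l.length]
    split
    · simp only [pure_steps]
      omega
    · split_ifs
      · simp only [pure_steps]
        omega
      · have := ih (scan S w q R j (queryLabel S w q j).val T
          (lowerBound (S.label j) (queryLabel S w q j).val 0 n le_rfl).val).val.1
        omega

theorem query_steps_le (S : Index n d M K L) (w : Fin d → ℝ) (q : Point d M) (R : ℝ)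
    (m : ℕ) (hm : n < 2 ^ m) :
    (query S w q R).steps
      ≤ ((8 * d + 10) * K + 6 * m + 9) * L + (8 * d + 9) * S.cutoff + 2 := by
  have := searchTables_steps_le S w q R m hm (List.finRange L) S.cutoff
  rw [List.length_finRange] at this
  simp only [query, bind_steps, op_steps, op_val]
  omega

/-! ### Correctness of the query algorithm -/

theorem lowerBound_spec (A : Fin n → ℝ) (hA : Monotone A) (x : ℝ) (lo hi : ℕ) (hhi : hi ≤ n) :
    lo ≤ (lowerBound A x lo hi hhi).val ∧
    (∀ i : Fin n, lo ≤ i → i < (lowerBound A x lo hi hhi).val → A i < x) ∧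
    (∀ i : Fin n, (lowerBound A x lo hi hhi).val ≤ i → i < hi → x ≤ A i) := by
  induction lo, hi, hhi using lowerBound.induct with
  | case1 lo hi hhi h ih ih' =>
    rw [lowerBound, dif_pos h]
    simp only [bind_val]
    split_ifs with hx
    · obtain ⟨h1, h2, h3⟩ := ih
      refine ⟨by omega, fun i hi1 hi2 => ?_, h3⟩
      by_cases hc : (lo + hi) / 2 + 1 ≤ i
      · exact h2 i hc hi2
      · exact (hA (show i ≤ ⟨(lo + hi) / 2, by omega⟩ from Fin.mk_le_mk.2 (by omega))).trans_lt hx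
    · obtain ⟨h1, h2, h3⟩ := ih'
      refine ⟨h1, h2, fun i hi1 hi2 => ?_⟩
      by_cases hc : i < (lo + hi) / 2
      · exact h3 i hi1 hc
      · exact (not_lt.1 hx).trans (hA (Fin.mk_le_mk.2 (by omega)))
  | case2 lo hi hhi h =>
    rw [lowerBound, dif_neg h]
    simp only [bind_val, pure_val]
    exact ⟨le_rfl, fun i _ _ => by omega, fun i _ _ => by omega⟩

theorem queryDist_val (S : Index n d M K L) (w : Fin d → ℝ) (q : Point d M) (i : Fin n) :
    (queryDist S w q i).val = wdist w (S.point i) q := by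
  rw [queryDist, sumLoop_val, ← List.ofFn_eq_map, List.sum_ofFn]
  rfl

theorem queryLabel_build_val (W : ℝ) (c : ℕ → ℝ) (T : ℕ) (ω : Seed d M K L) (D : Fin n → Point d M)
    (w : Fin d → ℝ) (q : Point d M) (j : Fin L) :
    (queryLabel (build W c T ω D) w q j).val
      = ∑ k : Fin K, c k * (hashQuery W (ω (j, k)) w q : ℝ) := by
  rw [queryLabel, sumLoop_val, ← List.ofFn_eq_map, List.sum_ofFn]
  refine Finset.sum_congr rfl fun k _ => ?_
  rw [← queryHash_build W c T ω D w q j k]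
  rfl

open Classical in
/-- The positions of table `j`, from `p` on, whose entry has label `x` but is farther than `R` from
the query. -/
def farFrom (S : Index n d M K L) (w : Fin d → ℝ) (q : Point d M) (R : ℝ) (j : Fin L) (x : ℝ)
    (p : ℕ) : Finset (Fin n) :=
  {i | p ≤ i ∧ S.label j i = x ∧ R < wdist w (S.point (S.member j i)) q}

theorem farFrom_anti (S : Index n d M K L) (w : Fin d → ℝ) (q : Point d M) (R : ℝ) (j : Fin L)
    (x : ℝ) {p p' : ℕ} (h : p ≤ p') : farFrom S w q R j x p' ⊆ farFrom S w q R j x p := by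
  intro i
  simp only [farFrom, Finset.mem_filter, Finset.mem_univ, true_and]
  exact fun ⟨h1, h2⟩ => ⟨h.trans h1, h2⟩

/-- A scan that finds nothing has used up only far candidates, and unless it ran out of candidates,
every entry of the run of labels `x` that starts at `p` is far. -/
theorem scan_spec (S : Index n d M K L) (w : Fin d → ℝ) (q : Point d M) (R : ℝ) (j : Fin L)
    (x : ℝ) (T p : ℕ) :
    (∃ i, (scan S w q R j x T p).val.2 = some i ∧ wdist w (S.point i) q ≤ R) ∨
    ((scan S w q R j x T p).val.2 = none ∧
      T ≤ (scan S w q R j x T p).val.1 + (farFrom S w q R j x p).card ∧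
      ((scan S w q R j x T p).val.1 = 0 ∨
        ∀ i : Fin n, p ≤ i → (∀ i' : Fin n, p ≤ (i' : ℕ) → i' ≤ i → S.label j i' = x) →
          R < wdist w (S.point (S.member j i)) q)) := by
  induction T generalizing p with
  | zero => simp [scan]
  | succ T ih =>
    by_cases h : p < n
    · by_cases hy : S.label j ⟨p, h⟩ = x
      · by_cases hr : (queryDist S w q (S.member j ⟨p, h⟩)).val ≤ R
        · left
          refine ⟨S.member j ⟨p, h⟩, ?_, by rwa [queryDist_val] at hr⟩
          simp only [scan, h, hy, hr, bind_val, op_val, dif_pos, if_pos, pure_val]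
        · have e : (scan S w q R j x (T + 1) p).val = (scan S w q R j x T (p + 1)).val := by
            simp only [scan, h, hy, hr, bind_val, op_val, dif_pos, if_pos, if_false]
          rw [queryDist_val] at hr
          rw [e]
          refine (ih (p + 1)).imp_right fun ⟨h1, h2, h3⟩ =>
            ⟨h1, ?_, h3.imp_right fun h4 i hi hl => ?_⟩
          · have hlt : (farFrom S w q R j x (p + 1)).card < (farFrom S w q R j x p).card := by
              refine Finset.card_lt_card
                ⟨farFrom_anti S w q R j x (Nat.le_succ p), fun hs => ?_⟩
              have : (⟨p, h⟩ : Fin n) ∈ farFrom S w q R j x (p + 1) := hs (by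
                simp only [farFrom, Finset.mem_filter, Finset.mem_univ, true_and]
                exact ⟨le_rfl, hy, not_le.1 hr⟩)
              simp [farFrom] at this
            omega
          · rcases hi.eq_or_lt with rfl | hi
            · exact not_le.1 hr
            · exact h4 i hi fun i' h5 h6 => hl i' (by omega) h6
      · right
        simp only [scan, h, hy, bind_val, op_val, dif_pos, if_false, pure_val, true_and]
        exact ⟨by omega, .inr fun i hi hl => absurd (hl ⟨p, h⟩ le_rfl hi) hy⟩
    · right
      simp only [scan, h, bind_val, dif_neg, not_false_eq_true, pure_val, true_and]
      exact ⟨by omega, .inr fun i hi hl => by omega⟩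

/-- A search that finds nothing either ran out of candidates on far points, or there is no near
point in any of the buckets of the query. -/
theorem searchTables_spec (S : Index n d M K L) (hS : ∀ j, Monotone (S.label j)) (w : Fin d → ℝ)
    (q : Point d M) (R : ℝ) (l : List (Fin L)) (T : ℕ) :
    (∃ i, (searchTables S w q R l T).val = some i ∧ wdist w (S.point i) q ≤ R) ∨
    T ≤ (l.map fun j => (farFrom S w q R j (queryLabel S w q j).val 0).card).sum ∨
    ∀ j ∈ l, ∀ i, S.label j i = (queryLabel S w q j).val →
      R < wdist w (S.point (S.member j i)) q := by
  induction l generalizing T with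
  | nil => simp
  | cons j l ih =>
    obtain ⟨-, hlo, hup⟩ := lowerBound_spec (S.label j) (hS j) (queryLabel S w q j).val 0 n le_rfl
    have hs := scan_spec S w q R j (queryLabel S w q j).val T
      (lowerBound (S.label j) (queryLabel S w q j).val 0 n le_rfl).val
    have hc := Finset.card_le_card (farFrom_anti S w q R j (queryLabel S w q j).val
      (Nat.zero_le (lowerBound (S.label j) (queryLabel S w q j).val 0 n le_rfl).val))
    simp only [searchTables, bind_val, List.map_cons, List.sum_cons]
    rcases hs with ⟨i, h1, h2⟩ | ⟨h1, h2, h3⟩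
    · left
      refine ⟨i, ?_, h2⟩
      rw [h1]
      rfl
    · rw [h1]
      by_cases h0 : (scan S w q R j (queryLabel S w q j).val T
        (lowerBound (S.label j) (queryLabel S w q j).val 0 n le_rfl).val).val.1 = 0
      · right; left; omega
      · simp only [if_neg h0]
        rcases ih (scan S w q R j (queryLabel S w q j).val T
          (lowerBound (S.label j) (queryLabel S w q j).val 0 n le_rfl).val).val.1 with h | h | h
        · exact .inl h
        · right; left; omega
        · right; right
          intro j' hj'
          rcases List.mem_cons.1 hj' with rfl | hj'
          · intro i hi
            -- The entries with the label of the query form an interval that starts at the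
            -- position found by the binary search.
            have hp : (lowerBound (S.label j') (queryLabel S w q j').val 0 n le_rfl).val ≤ i := by
              by_contra hlt
              exact (hlo i (Nat.zero_le _) (not_le.1 hlt)).ne hi
            exact h3.resolve_left h0 i hp fun i' h4 h5 =>
              le_antisymm (hi ▸ hS j' h5) (hup i' h4 i'.2)
          · exact h j' hj'

open Classical in
/-- The query on a built index fails only if the buckets of the query hold at least `T` far
candidates, or no near point. Linear independence of `c` over `ℚ` makes the labels faithful. -/
theorem isNNSAnswer_query_build (W : ℝ) {c : ℕ → ℝ} (hc : LinearIndependent ℚ c) (T : ℕ)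
    (ω : Seed d M K L) (D : Fin n → Point d M) (w : Fin d → ℝ) (q : Point d M) (R₁ R₂ : ℝ)
    (hR : R₁ ≤ R₂)
    (hT : ∑ j, (Finset.univ.filter fun i => R₂ < wdist w (D i) q ∧
      ∀ k, hashData W (ω (j, k)) (D i) = hashQuery W (ω (j, k)) w q).card < T)
    (hcol : ∃ i j, wdist w (D i) q ≤ R₁ ∧
      ∀ k, hashData W (ω (j, k)) (D i) = hashQuery W (ω (j, k)) w q) :
    IsNNSAnswer (wdist w) R₁ R₂ D q (query (build W c T ω D) w q R₂).val := by
  have hlab : ∀ j i, dataLabel W c ω j (D i) = (queryLabel (build W c T ω D) w q j).val ↔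
      ∀ k, hashData W (ω (j, k)) (D i) = hashQuery W (ω (j, k)) w q := by
    intro j i
    rw [queryLabel_build_val, dataLabel]
    refine ⟨fun h k => ?_, fun h => by simp [h]⟩
    have h2 := Fintype.linearIndependent_iff.1 (hc.comp _ (Fin.val_injective (n := K)))
      (fun k => ((hashData W (ω (j, k)) (D i) - hashQuery W (ω (j, k)) w q : ℤ) : ℚ)) (by
        rw [← sub_eq_zero, ← Finset.sum_sub_distrib] at h
        rw [← h]
        refine Finset.sum_congr rfl fun k _ => ?_
        rw [Rat.smul_def]
        push_cast
        simp only [Function.comp]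
        ring) k
    exact sub_eq_zero.1 (by exact_mod_cast h2)
  intro _
  obtain ⟨i, j, hi, hj⟩ := hcol
  rcases searchTables_spec (build W c T ω D) (fun j =>
    Tuple.monotone_sort fun i => dataLabel W c ω j (D i)) w q R₂
    (List.finRange L) T with h | h | h
  · exact h
  · exfalso
    rw [← List.ofFn_eq_map, List.sum_ofFn] at h
    refine absurd (h.trans_eq (Finset.sum_congr rfl fun j _ => ?_)) (not_le.2 hT)
    refine Finset.card_equiv (Tuple.sort fun i => dataLabel W c ω j (D i)) fun p => ?_
    simp only [farFrom, Finset.mem_filter, Finset.mem_univ, true_and, ← hlab]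
    exact ⟨fun h => ⟨h.2.2, h.2.1⟩, fun h => ⟨Nat.zero_le _, h.2, h.1⟩⟩
  · exfalso
    have := h j (List.mem_finRange j) ((Tuple.sort fun i => dataLabel W c ω j (D i)).symm i) (by
      rw [← (hlab j i).2 hj]
      simp [build])
    simp only [build, Equiv.apply_symm_apply] at this
    linarith

/-! ### The collision probability of the hash functions -/

/-- A random shift separates two numbers, in the partition into intervals of length `W`, with
probability proportional to their distance (capped at `1`). -/
theorem cond_floor_eq {W : ℝ} (hW : 0 < W) (s t : ℝ) :
    cond volume (Set.Icc 0 W) {b | ⌊(s + b) / W⌋ = ⌊(t + b) / W⌋}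
      = ENNReal.ofReal (max 0 (1 - |s - t| / W)) := by
  set A : Set ℝ := {b | ⌊(s + b) / W⌋ = ⌊(t + b) / W⌋} with hA
  have hAm : MeasurableSet A := measurableSet_eq_fun (by fun_prop) (by fun_prop)
  have hper : volume (A ∩ Set.Ioc 0 (0 + W)) = volume (A ∩ Set.Ioc (-s) (-s + W)) := by
    refine IsAddFundamentalDomain.measure_set_eq (G := AddSubgroup.zmultiples W)
      (isAddFundamentalDomain_Ioc hW 0) (isAddFundamentalDomain_Ioc hW (-s)) hAm ?_
    rintro ⟨_, k, rfl⟩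
    ext b
    have h : ∀ u : ℝ, ⌊(u + (k * W + b)) / W⌋ = ⌊(u + b) / W⌋ + k := fun u => by
      rw [← Int.floor_add_intCast]
      congr 1
      field_simp
      ring
    simp [hA, AddSubgroup.vadd_def, h]
  -- `A` has period `W`; in the window where `s + b` lies in `[0, W)`, it is an interval.
  have hset : A ∩ Set.Ico (-s) (-s + W)
      = Set.Ico (max (-s) (-t)) (min (-s + W) (-t + W)) := by
    ext b
    simp only [hA, Set.mem_inter_iff, Set.mem_ofPred_eq, Set.mem_Ico, max_le_iff, lt_min_iff]
    have hz : ∀ u : ℝ, ⌊(u + b) / W⌋ = 0 ↔ -u ≤ b ∧ b < -u + W := fun u => by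
      rw [Int.floor_eq_zero_iff, Set.mem_Ico, div_lt_one hW, le_div_iff₀ hW, zero_mul]
      constructor <;> rintro ⟨h1, h2⟩ <;> constructor <;> linarith
    constructor
    · rintro ⟨h1, h2⟩
      have h3 := (hz t).1 (h1 ▸ (hz s).2 h2)
      exact ⟨⟨h2.1, h3.1⟩, h2.2, h3.2⟩
    · rintro ⟨⟨h1, h2⟩, h3, h4⟩
      exact ⟨((hz s).2 ⟨h1, h3⟩).trans ((hz t).2 ⟨h2, h4⟩).symm, h1, h3⟩
  have hvol : volume (Set.Icc 0 W ∩ A) = ENNReal.ofReal (W - |s - t|) := by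
    rw [Set.inter_comm, ← measure_congr ((ae_eq_refl A).inter Ioc_ae_eq_Icc)]
    rw [zero_add] at hper
    rw [hper, ← measure_congr ((ae_eq_refl A).inter Ico_ae_eq_Ioc), hset, Real.volume_Ico]
    congr 1
    rcases le_total s t with h | h
    · rw [max_eq_left (by linarith), min_eq_right (by linarith), abs_of_nonpos (by linarith)]
      ring
    · rw [max_eq_right (by linarith), min_eq_left (by linarith), abs_of_nonneg (by linarith)]
      ring
  rw [cond_apply measurableSet_Icc, hvol, Real.volume_Icc, sub_zero, ← ENNReal.ofReal_inv_of_pos hW,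
    ← ENNReal.ofReal_mul (inv_nonneg.2 hW.le), ENNReal.ofReal_max, ENNReal.ofReal_zero,
    max_eq_right (zero_le)]
  congr 1
  field_simp

/-- A linear combination of independent standard normal variables is distributed like a standard
normal variable times the Euclidean norm of the coefficients. -/
theorem map_pi_gaussianReal_sum {ι : Type} [Fintype ι] (u : ι → ℝ) :
    (Measure.pi fun _ : ι => gaussianReal 0 1).map (fun a => ∑ i, a i * u i)
      = (gaussianReal 0 1).map (√(∑ i, u i ^ 2) * ·) := by
  have hind : iIndepFun (fun i (a : ι → ℝ) => a i * u i)
      (Measure.pi fun _ : ι => gaussianReal 0 1) :=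
    iIndepFun_pi (μ := fun _ : ι => gaussianReal 0 1) (X := fun i (x : ℝ) => x * u i)
      fun i => by fun_prop
  -- Both laws have characteristic function `exp (-(∑ i, u i ^ 2) * s ^ 2 / 2)`.
  refine Measure.ext_of_charFun ?_
  rw [hind.charFun_map_fun_sum_eq_prod fun i => Measurable.aemeasurable (by fun_prop)]
  ext s
  have hi : ∀ i, (Measure.pi fun _ : ι => gaussianReal 0 1).map (fun a => a i * u i)
      = (gaussianReal 0 1).map (· * u i) := fun i => by
    conv_rhs => rw [← (measurePreserving_eval (fun _ : ι => gaussianReal 0 1) i).map_eq,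
      Measure.map_map (by fun_prop) (by fun_prop)]
    rfl
  simp only [hi, gaussianReal_map_mul_const, gaussianReal_map_const_mul, Finset.prod_apply,
    charFun_gaussianReal, ← Complex.exp_sum]
  congr 1
  have : 0 ≤ ∑ i, u i ^ 2 := Finset.sum_nonneg fun i _ => sq_nonneg _
  simp [Real.sq_sqrt this, Finset.sum_div, Finset.sum_mul]

/-- The collision probability as a Gaussian mean of the probability that a random shift does not
separate two numbers at distance `|r * z|`. -/
def meanTent (W r : ℝ) : ℝ := ∫ z, max 0 (1 - |r * z| / W) ∂gaussianReal 0 1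

theorem integrable_tent {W : ℝ} (hW : 0 < W) (r : ℝ) :
    Integrable (fun z => max 0 (1 - |r * z| / W)) (gaussianReal 0 1) := by
  refine Integrable.of_bound (C := 1) (by fun_prop) (.of_forall fun z => ?_)
  rw [Real.norm_of_nonneg (le_max_left _ _)]
  have : 0 ≤ |r * z| / W := by positivity
  exact max_le zero_le_one (by linarith)

theorem lawL2_hashL2_eq {ι : Type} [Fintype ι] {W : ℝ} (hW : 0 < W) (x y : ι → ℝ) :
    lawL2 ι W {ab | hashL2 W ab x = hashL2 W ab y}
      = ENNReal.ofReal (meanTent W √(∑ i, (x i - y i) ^ 2)) := by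
  have : IsProbabilityMeasure (cond volume (Set.Icc 0 W)) :=
    cond_isProbabilityMeasure_of_finite (by simp [hW]) (by simp)
  have hm : MeasurableSet {ab : (ι → ℝ) × ℝ | hashL2 W ab x = hashL2 W ab y} :=
    measurableSet_eq_fun (by unfold hashL2; fun_prop) (by unfold hashL2; fun_prop)
  rw [lawL2, Measure.prod_apply hm, meanTent,
    ofReal_integral_eq_lintegral_ofReal (integrable_tent hW _)
      (.of_forall fun z => le_max_left _ _)]
  have h1 : ∀ a : ι → ℝ, cond volume (Set.Icc 0 W)
      (Prod.mk a ⁻¹' {ab : (ι → ℝ) × ℝ | hashL2 W ab x = hashL2 W ab y})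
      = ENNReal.ofReal (max 0 (1 - |∑ i, a i * (x i - y i)| / W)) := fun a => by
    rw [show ∑ i, a i * (x i - y i) = ∑ i, a i * x i - ∑ i, a i * y i by
      rw [← Finset.sum_sub_distrib]; simp only [mul_sub], ← cond_floor_eq hW]
    rfl
  simp only [h1]
  rw [← lintegral_map (f := fun s => ENNReal.ofReal (max 0 (1 - |s| / W)))
    (g := fun a : ι → ℝ => ∑ i, a i * (x i - y i)) (by fun_prop) (by fun_prop),
    map_pi_gaussianReal_sum, lintegral_map (by fun_prop) (by fun_prop)]

theorem meanTent_nonneg (W r : ℝ) : 0 ≤ meanTent W r :=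
  integral_nonneg fun _ => le_max_left _ _

theorem meanTent_zero (W : ℝ) : meanTent W 0 = 1 := by simp [meanTent]

theorem meanTent_lt {W : ℝ} (hW : 0 < W) {r s : ℝ} (hr : 0 ≤ r) (hrs : r < s) :
    meanTent W s < meanTent W r := by
  have hle : ∀ z, |r * z| / W ≤ |s * z| / W := fun z => by
    rw [abs_mul, abs_mul, abs_of_nonneg hr, abs_of_pos (hr.trans_lt hrs)]
    gcongr
  rw [← sub_pos, meanTent, meanTent, ← integral_sub (integrable_tent hW r) (integrable_tent hW s),
    integral_pos_iff_support_of_nonneg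
      (fun z => sub_nonneg.2 (max_le_max le_rfl (by linarith [hle z])))
      ((integrable_tent hW r).sub (integrable_tent hW s)), pos_iff_ne_zero]
  intro h0
  have hs : 0 < s := hr.trans_lt hrs
  have hvol := gaussianReal_absolutelyContinuous' 0 one_ne_zero h0
  have hsub : Set.Ioo 0 (W / s) ⊆ Function.support
      fun z => max 0 (1 - |r * z| / W) - max 0 (1 - |s * z| / W) := by
    rintro z ⟨hz, hz'⟩
    rw [lt_div_iff₀ hs] at hz'
    have h1 : r * z / W < s * z / W := by gcongr
    have h2 : s * z / W < 1 := by rw [div_lt_one hW]; linarith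
    refine (sub_pos.2 ?_).ne'
    rw [abs_of_pos (mul_pos hs hz), abs_of_nonneg (mul_nonneg hr hz.le)]
    exact lt_max_of_lt_right (max_lt (by linarith) (by linarith))
  have := measure_mono_null hsub hvol
  rw [Real.volume_Ioo, ENNReal.ofReal_eq_zero, sub_zero] at this
  exact absurd (div_pos hW hs) (not_lt.2 this)

theorem meanTent_anti {W : ℝ} (hW : 0 < W) {r s : ℝ} (hr : 0 ≤ r) (hrs : r ≤ s) :
    meanTent W s ≤ meanTent W r := by
  rcases hrs.eq_or_lt with rfl | h
  · exact le_rfl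
  · exact (meanTent_lt hW hr h).le

theorem meanTent_pos {W : ℝ} (hW : 0 < W) {r : ℝ} (hr : 0 ≤ r) : 0 < meanTent W r :=
  (meanTent_nonneg W (r + 1)).trans_lt (meanTent_lt hW hr (lt_add_one r))

theorem meanTent_le_one {W : ℝ} (hW : 0 < W) {r : ℝ} (hr : 0 ≤ r) : meanTent W r ≤ 1 :=
  (meanTent_anti hW le_rfl hr).trans_eq (meanTent_zero W)

/-- The Gaussian integral of an even function that vanishes outside `[-t, t]`. -/
theorem integral_gaussianReal_abs {t : ℝ} (ht : 0 < t) (f : ℝ → ℝ) (hf : ∀ z, t < z → f z = 0) :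
    ∫ z, f |z| ∂gaussianReal 0 1 = 2 * ∫ z in (0 : ℝ)..t, gaussianPDFReal 0 1 z * f z := by
  rw [integral_gaussianReal_eq_integral_smul one_ne_zero]
  have h1 : ∀ z, gaussianPDFReal 0 1 z • f |z|
      = (fun z => gaussianPDFReal 0 1 z * f z) |z| := fun z => by
    simp [gaussianPDFReal, smul_eq_mul]
  simp only [h1]
  rw [integral_comp_abs (f := fun z => gaussianPDFReal 0 1 z * f z),
    intervalIntegral.integral_of_le ht.le]
  congr 1
  refine setIntegral_eq_of_subset_of_forall_sdiff_eq_zero measurableSet_Ioi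
    (fun z hz => hz.1) fun z hz => ?_
  rw [hf z, mul_zero]
  by_contra hle
  exact hz.2 ⟨hz.1, not_lt.1 hle⟩

theorem one_sub_two_mul_cdf {t : ℝ} (ht : 0 < t) :
    1 - 2 * cdf (gaussianReal 0 1) (-t) = 2 * ∫ z in (0 : ℝ)..t, gaussianPDFReal 0 1 z := by
  have h1 := integral_gaussianReal_abs ht (Set.indicator (Set.Iic t) 1) (fun z hz => by
    simp [hz])
  have h2 : ∫ z in (0 : ℝ)..t, gaussianPDFReal 0 1 z * Set.indicator (Set.Iic t) 1 z
      = ∫ z in (0 : ℝ)..t, gaussianPDFReal 0 1 z := by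
    refine intervalIntegral.integral_congr fun z hz => ?_
    rw [Set.uIcc_of_le ht.le] at hz
    simp [hz.2]
  rw [h2] at h1
  rw [← h1]
  have h3 : ∀ z : ℝ, Set.indicator (Set.Iic t) (1 : ℝ → ℝ) |z|
      = 1 - (Set.indicator (Set.Iio (-t)) 1 z + Set.indicator (Set.Ioi t) 1 z) := fun z => by
    by_cases ha : t < z
    · have : t < |z| := ha.trans_le (le_abs_self z)
      have : ¬ z < -t := by linarith
      simp [*]
    · by_cases hb : z < -t
      · have : t < |z| := (by linarith : t < -z).trans_le (neg_le_abs z)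
        simp [*]
      · have : |z| ≤ t := abs_le.2 ⟨by linarith, by linarith⟩
        simp [*]
  have hsymm : (gaussianReal 0 1).real (Set.Ioi t) = (gaussianReal 0 1).real (Set.Iio (-t)) := by
    have := gaussianReal_map_neg (μ := 0) (v := 1)
    rw [neg_zero] at this
    conv_lhs => rw [← this]
    rw [map_measureReal_apply measurable_neg measurableSet_Ioi]
    congr 1
    ext z
    simp
  have : NullSingletonClass (gaussianReal 0 1) := nullSingletonClass_gaussianReal one_ne_zero
  rw [cdf_eq_real]
  simp only [h3]
  rw [integral_sub (integrable_const _) (((integrable_indicator_iff measurableSet_Iio).2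
      (integrable_const _).integrableOn).add ((integrable_indicator_iff measurableSet_Ioi).2
      (integrable_const _).integrableOn)),
    integral_add ((integrable_indicator_iff measurableSet_Iio).2
      (integrable_const _).integrableOn) ((integrable_indicator_iff measurableSet_Ioi).2
      (integrable_const _).integrableOn), integral_indicator_one measurableSet_Iio,
    integral_indicator_one measurableSet_Ioi, hsymm,
    measureReal_congr (Iio_ae_eq_Iic (μ := gaussianReal 0 1) (a := -t))]
  simp only [integral_const, probReal_univ, smul_eq_mul, mul_one]
  ring

theorem integral_mul_gaussianPDFReal (t : ℝ) :
    ∫ z in (0 : ℝ)..t, z * gaussianPDFReal 0 1 z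
      = (√(2 * Real.pi))⁻¹ * (1 - Real.exp (-(t ^ 2 / 2))) := by
  have hd : ∀ z : ℝ,
      HasDerivAt (fun z => -gaussianPDFReal 0 1 z) (z * gaussianPDFReal 0 1 z) z := by
    intro z
    have h : HasDerivAt (fun z : ℝ => -z ^ 2 / 2) (-z) z := by
      convert! ((hasDerivAt_pow 2 z).neg.div_const 2) using 1
      simp; ring
    have := (h.exp.const_mul (√(2 * Real.pi))⁻¹).neg
    simp only [gaussianPDFReal, sub_zero, NNReal.coe_one, mul_one]
    convert! this using 1
    ring
  rw [intervalIntegral.integral_eq_sub_of_hasDerivAt (fun z _ => hd z)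
    (Continuous.intervalIntegrable (by unfold gaussianPDFReal; fun_prop) _ _)]
  simp [gaussianPDFReal, neg_div]
  ring

/-- The closed formula for the collision probability agrees with the Gaussian mean. -/
theorem collL2_eq_meanTent {W : ℝ} (hW : 0 < W) {r : ℝ} (hr : 0 ≤ r) :
    collL2 W r = meanTent W r := by
  rcases hr.eq_or_lt with rfl | hr
  · simp [collL2, meanTent_zero]
  have ht : 0 < W / r := div_pos hW hr
  have h1 := integral_gaussianReal_abs ht (fun z => max 0 (1 - r * z / W)) fun z hz => by
    rw [div_lt_iff₀ hr] at hz
    have : 1 ≤ r * z / W := by rw [one_le_div hW]; linarith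
    exact max_eq_left (by linarith)
  have h2 : ∫ z in (0 : ℝ)..W / r, gaussianPDFReal 0 1 z * max 0 (1 - r * z / W)
      = ∫ z in (0 : ℝ)..W / r,
        (gaussianPDFReal 0 1 z - r / W * (z * gaussianPDFReal 0 1 z)) := by
    refine intervalIntegral.integral_congr fun z hz => ?_
    rw [Set.uIcc_of_le ht.le, Set.mem_Icc, le_div_iff₀ hr] at hz
    have : r * z / W ≤ 1 := by rw [div_le_one hW]; linarith
    rw [max_eq_right (by linarith)]
    ring
  have hc : Continuous (gaussianPDFReal 0 1) := by unfold gaussianPDFReal; fun_prop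
  rw [collL2, if_neg hr.ne', one_sub_two_mul_cdf ht, meanTent]
  simp only [abs_mul, abs_of_pos hr]
  rw [h1, h2, intervalIntegral.integral_sub (hc.intervalIntegrable _ _)
    (Continuous.intervalIntegrable (by fun_prop) _ _), intervalIntegral.integral_const_mul,
    integral_mul_gaussianPDFReal, show W ^ 2 / (2 * r ^ 2) = (W / r) ^ 2 / 2 by field_simp]
  field_simp

/-- The transformations turn the weighted Manhattan distance into the Euclidean distance. -/
theorem sum_preTrans_sub_queryTrans_sq (w : Fin d → ℝ) (o q : Point d M) :
    ∑ i, (preTrans o i - queryTrans w q i) ^ 2 = transDistSq d M w (wdist w o q) := by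
  -- The two summands of a pair `ij` contribute `1 + w i ^ 2`, less `2 * w i` if the codes agree.
  have hterm : ∀ ij : Fin d × Fin M,
      (preTrans o (.inl ij) - queryTrans w q (.inl ij)) ^ 2
        + (preTrans o (.inr ij) - queryTrans w q (.inr ij)) ^ 2
      = 1 + w ij.1 ^ 2 - 2 * w ij.1 + 2 * w ij.1 * |unary o ij - unary q ij| := fun ij => by
    simp only [preTrans, queryTrans, Sum.elim_inl, Sum.elim_inr, unary]
    split_ifs <;> simp <;> ring
  have hcount : ∀ i, ∑ m : Fin M, |unary o (i, m) - unary q (i, m)|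
      = |((o i : ℕ) : ℝ) - ((q i : ℕ) : ℝ)| := by
    have hu : ∀ a : Fin (M + 1), ∑ m : Fin M, (if (m : ℕ) < (a : ℕ) then (1 : ℝ) else 0)
        = ((a : ℕ) : ℝ) := fun a => by
      rw [Fin.sum_univ_eq_sum_range (fun m => if m < (a : ℕ) then (1 : ℝ) else 0) M,
        Finset.sum_ite, Finset.sum_const_zero, add_zero, Finset.sum_const, nsmul_one]
      congr 1
      rw [show (Finset.range M).filter (· < (a : ℕ)) = Finset.range a by
        ext m
        simp only [Finset.mem_filter, Finset.mem_range]
        omega, Finset.card_range]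
    have key : ∀ a b : Fin (M + 1), (b : ℕ) ≤ (a : ℕ) → ∑ m : Fin M,
        |(if (m : ℕ) < (a : ℕ) then (1 : ℝ) else 0) - (if (m : ℕ) < (b : ℕ) then (1 : ℝ) else 0)|
        = |((a : ℕ) : ℝ) - ((b : ℕ) : ℝ)| := fun a b hab => by
      rw [abs_of_nonneg (sub_nonneg.2 (by exact_mod_cast hab)), ← hu a, ← hu b,
        ← Finset.sum_sub_distrib]
      refine Finset.sum_congr rfl fun m _ => abs_of_nonneg ?_
      split_ifs <;> first | omega | simp
    intro i
    simp only [unary]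
    rcases le_total (q i : ℕ) (o i : ℕ) with h | h
    · exact key _ _ h
    · rw [abs_sub_comm, ← key _ _ h]
      exact Finset.sum_congr rfl fun m _ => abs_sub_comm _ _
  rw [Fintype.sum_sum_type, ← Finset.sum_add_distrib]
  simp only [hterm]
  rw [Fintype.sum_prod_type]
  simp only [Finset.sum_add_distrib, Finset.sum_sub_distrib, ← Finset.mul_sum, hcount]
  simp only [Finset.sum_const, Finset.card_univ, Fintype.card_fin, nsmul_eq_mul, transDistSq,
    wdist, ← Finset.mul_sum, mul_assoc]
  ring

theorem lawL2_hashData_eq_hashQuery {W : ℝ} (hW : 0 < W) (w : Fin d → ℝ) (o q : Point d M) :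
    lawL2 (Coord d M) W {ab | hashData W ab o = hashQuery W ab w q}
      = ENNReal.ofReal (collProb d M W w (wdist w o q)) := by
  rw [collProb, collL2_eq_meanTent hW (Real.sqrt_nonneg _), ← sum_preTrans_sub_queryTrans_sq]
  exact lawL2_hashL2_eq hW _ _

theorem collProb_anti {W : ℝ} (hW : 0 < W) (w : Fin d → ℝ) {r s : ℝ} (h : r ≤ s) :
    collProb d M W w s ≤ collProb d M W w r := by
  rw [collProb, collProb, collL2_eq_meanTent hW (Real.sqrt_nonneg _),
    collL2_eq_meanTent hW (Real.sqrt_nonneg _)]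
  refine meanTent_anti hW (Real.sqrt_nonneg _) (Real.sqrt_le_sqrt ?_)
  unfold transDistSq
  linarith

theorem collProb_lt {W : ℝ} (hW : 0 < W) (w : Fin d → ℝ) {r s : ℝ} (h : r < s)
    (hr : 0 ≤ transDistSq d M w r) : collProb d M W w s < collProb d M W w r := by
  rw [collProb, collProb, collL2_eq_meanTent hW (Real.sqrt_nonneg _),
    collL2_eq_meanTent hW (Real.sqrt_nonneg _)]
  refine meanTent_lt hW (Real.sqrt_nonneg _) (Real.sqrt_lt_sqrt hr ?_)
  unfold transDistSq
  linarith

theorem collProb_pos {W : ℝ} (hW : 0 < W) (w : Fin d → ℝ) (r : ℝ) :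
    0 < collProb d M W w r := by
  rw [collProb, collL2_eq_meanTent hW (Real.sqrt_nonneg _)]
  exact meanTent_pos hW (Real.sqrt_nonneg _)

theorem collProb_le_one {W : ℝ} (hW : 0 < W) (w : Fin d → ℝ) (r : ℝ) :
    collProb d M W w r ≤ 1 := by
  rw [collProb, collL2_eq_meanTent hW (Real.sqrt_nonneg _)]
  exact meanTent_le_one hW (Real.sqrt_nonneg _)

/-! ### The probability of an incorrect answer -/

/-- The rows of a matrix with independent, identically distributed entries are independent. -/
theorem pi_rows_apply {ι κ Ω : Type} [Fintype ι] [Fintype κ] [MeasurableSpace Ω] (μ : Measure Ω)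
    [IsProbabilityMeasure μ] (B : ι → Set (κ → Ω)) (hB : ∀ j, MeasurableSet (B j)) :
    (Measure.pi fun _ : ι × κ => μ) {ω | ∀ j, (fun k => ω (j, k)) ∈ B j}
      = ∏ j, (Measure.pi fun _ : κ => μ) (B j) := by
  have hm : Measurable fun (f : ι → κ → Ω) (p : ι × κ) => f p.1 p.2 := by fun_prop
  have hmap : (Measure.pi fun _ : ι × κ => μ)
      = (Measure.pi fun _ : ι => Measure.pi fun _ : κ => μ).map fun f p => f p.1 p.2 := by
    refine Measure.pi_eq fun s hs => ?_
    rw [Measure.map_apply hm (.univ_pi hs), Fintype.prod_prod_type]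
    have : (fun (f : ι → κ → Ω) (p : ι × κ) => f p.1 p.2) ⁻¹' Set.univ.pi s
        = Set.univ.pi fun i => Set.univ.pi fun k => s (i, k) := by
      ext f
      simp [Set.mem_pi]
    rw [this, Measure.pi_pi]
    simp only [Measure.pi_pi]
  have hrow : ∀ j, Measurable fun (ω : ι × κ → Ω) k => ω (j, k) := fun j => by fun_prop
  have hms : MeasurableSet {ω : ι × κ → Ω | ∀ j, (fun k => ω (j, k)) ∈ B j} := by
    have : {ω : ι × κ → Ω | ∀ j, (fun k => ω (j, k)) ∈ B j}
        = ⋂ j, (fun (ω : ι × κ → Ω) k => ω (j, k)) ⁻¹' B j := by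
      ext ω
      simp
    rw [this]
    exact .iInter fun j => hrow j (hB j)
  rw [hmap, Measure.map_apply hm hms, ← Measure.pi_pi]
  congr 1
  ext f
  simp [Set.mem_pi]

theorem isProbabilityMeasure_lawL2 (ι : Type) [Fintype ι] {W : ℝ} (hW : 0 < W) :
    IsProbabilityMeasure (lawL2 ι W) := by
  have : IsProbabilityMeasure (cond volume (Set.Icc 0 W)) :=
    cond_isProbabilityMeasure_of_finite (by simp [hW]) (by simp)
  unfold lawL2
  infer_instance

/-- The choices of the `K` hash functions of a table that put the data point `o` into the bucket of
the query. -/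
def sameBucket (K : ℕ) (W : ℝ) (w : Fin d → ℝ) (o q : Point d M) :
    Set (Fin K → (Coord d M → ℝ) × ℝ) :=
  Set.univ.pi fun _ => {ab | hashData W ab o = hashQuery W ab w q}

theorem measurableSet_sameBucket (K : ℕ) (W : ℝ) (w : Fin d → ℝ) (o q : Point d M) :
    MeasurableSet (sameBucket K W w o q) :=
  .univ_pi fun _ => measurableSet_eq_fun (by unfold hashData hashL2; fun_prop)
    (by unfold hashQuery hashL2; fun_prop)

theorem pi_sameBucket (K : ℕ) {W : ℝ} (hW : 0 < W) (w : Fin d → ℝ) (o q : Point d M) :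
    (Measure.pi fun _ : Fin K => lawL2 (Coord d M) W) (sameBucket K W w o q)
      = ENNReal.ofReal (collProb d M W w (wdist w o q) ^ K) := by
  have := isProbabilityMeasure_lawL2 (Coord d M) hW
  rw [sameBucket, Measure.pi_pi]
  simp only [lawL2_hashData_eq_hashQuery hW]
  rw [Finset.prod_const, Finset.card_univ, Fintype.card_fin,
    ENNReal.ofReal_pow (collProb_pos hW w _).le]

theorem seedLaw_row_mem_sameBucket {W : ℝ} (hW : 0 < W) (w : Fin d → ℝ) (o q : Point d M)
    (j : Fin L) :
    seedLaw d M K L W {ω | (fun k => ω (j, k)) ∈ sameBucket K W w o q}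
      = ENNReal.ofReal (collProb d M W w (wdist w o q) ^ K) := by
  have := isProbabilityMeasure_lawL2 (Coord d M) hW
  have h := pi_rows_apply (lawL2 (Coord d M) W)
    (fun j' : Fin L => if j' = j then sameBucket K W w o q else Set.univ) fun j' => by
      split_ifs
      exacts [measurableSet_sameBucket K W w o q, .univ]
  rw [Finset.prod_eq_single j (fun j' _ hj => by simp [hj]) (by simp), if_pos rfl,
    pi_sameBucket K hW] at h
  rw [seedLaw, ← h]
  congr 1
  ext ω
  constructor
  · intro hω j'
    by_cases hj : j' = j
    · subst hj
      simpa using hω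
    · simp [hj]
  · intro hω
    simpa using hω j

theorem seedLaw_forall_row_notMem_sameBucket {W : ℝ} (hW : 0 < W) (w : Fin d → ℝ)
    (o q : Point d M) :
    seedLaw d M K L W {ω | ∀ j, (fun k => ω (j, k)) ∉ sameBucket K W w o q}
      = ENNReal.ofReal ((1 - collProb d M W w (wdist w o q) ^ K) ^ L) := by
  have := isProbabilityMeasure_lawL2 (Coord d M) hW
  have h := pi_rows_apply (lawL2 (Coord d M) W)
    (fun _ : Fin L => (sameBucket K W w o q)ᶜ)
    fun _ => (measurableSet_sameBucket K W w o q).compl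
  have hp := collProb_pos (M := M) hW w (wdist w o q)
  rw [Finset.prod_const, Finset.card_univ, Fintype.card_fin,
    prob_compl_eq_one_sub (measurableSet_sameBucket K W w o q), pi_sameBucket K hW,
    ← ENNReal.ofReal_one, ← ENNReal.ofReal_sub _ (pow_nonneg hp.le _), ← ENNReal.ofReal_pow
      (sub_nonneg.2 (pow_le_one₀ hp.le (collProb_le_one hW w _)))] at h
  exact h

open Classical in
/-- Markov's inequality for the number of far candidates. -/
theorem seedLaw_le_card_far {W : ℝ} (hW : 0 < W) (w : Fin d → ℝ) (R₂ : ℝ)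
    (D : Fin n → Point d M) (q : Point d M) {T : ℕ} (hT : 0 < T) {ε : ℝ} (hε : 0 ≤ ε)
    (h : L * (n * collProb d M W w R₂ ^ K) ≤ ε * T) :
    seedLaw d M K L W {ω | T ≤ ∑ j, (Finset.univ.filter fun i => R₂ < wdist w (D i) q ∧
      ∀ k, hashData W (ω (j, k)) (D i) = hashQuery W (ω (j, k)) w q).card} ≤ ENNReal.ofReal ε := by
  set E : Fin L → Fin n → Set (Seed d M K L) := fun j i =>
    {ω | (fun k => ω (j, k)) ∈ sameBucket K W w (D i) q} with hE
  have hEm : ∀ j i, MeasurableSet (E j i) := fun j i =>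
    (by fun_prop : Measurable fun (ω : Seed d M K L) k => ω (j, k))
      (measurableSet_sameBucket K W w (D i) q)
  have hcount : ∀ ω : Seed d M K L,
      ((∑ j, (Finset.univ.filter fun i => R₂ < wdist w (D i) q ∧
        ∀ k, hashData W (ω (j, k)) (D i) = hashQuery W (ω (j, k)) w q).card : ℕ) : ℝ≥0∞)
      = ∑ j, ∑ i with R₂ < wdist w (D i) q, (E j i).indicator 1 ω := fun ω => by
    push_cast
    refine Finset.sum_congr rfl fun j _ => ?_
    rw [← Finset.filter_filter, Finset.card_filter]
    push_cast
    refine Finset.sum_congr rfl fun i _ => ?_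
    simp [hE, sameBucket, Set.indicator_apply, Set.mem_pi]
  have hset : {ω : Seed d M K L | T ≤ ∑ j, (Finset.univ.filter fun i => R₂ < wdist w (D i) q ∧
      ∀ k, hashData W (ω (j, k)) (D i) = hashQuery W (ω (j, k)) w q).card}
      = {ω | (T : ℝ≥0∞) ≤ ∑ j, ∑ i with R₂ < wdist w (D i) q, (E j i).indicator 1 ω} := by
    ext ω
    rw [Set.mem_ofPred_eq, Set.mem_ofPred_eq, ← hcount, Nat.cast_le]
  have hmean : ∀ j i, ∫⁻ ω, (E j i).indicator 1 ω ∂seedLaw d M K L W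
      = ENNReal.ofReal (collProb d M W w (wdist w (D i) q) ^ K) := fun j i => by
    rw [lintegral_indicator_one (hEm j i), hE, seedLaw_row_mem_sameBucket hW]
  have hind : ∀ j i, Measurable ((E j i).indicator (1 : Seed d M K L → ℝ≥0∞)) := fun j i =>
    measurable_one.indicator (hEm j i)
  rw [hset]
  refine (meas_ge_le_lintegral_div (by fun_prop) (by exact_mod_cast hT.ne')
    (ENNReal.natCast_ne_top T)).trans (ENNReal.div_le_of_le_mul ?_)
  rw [lintegral_finsetSum _ fun j _ => by fun_prop]
  calc ∑ j, ∫⁻ ω, ∑ i with R₂ < wdist w (D i) q, (E j i).indicator 1 ω ∂seedLaw d M K L W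
      ≤ ∑ _j : Fin L, ∑ _i : Fin n, ENNReal.ofReal (collProb d M W w R₂ ^ K) := by
        refine Finset.sum_le_sum fun j _ => ?_
        rw [lintegral_finsetSum _ fun i _ => hind j i]
        refine (Finset.sum_le_sum fun i hi => ?_).trans
          (Finset.sum_le_sum_of_subset (Finset.filter_subset _ _))
        rw [hmean]
        exact ENNReal.ofReal_le_ofReal (pow_le_pow_left₀ (collProb_pos hW w _).le
          (collProb_anti hW w (Finset.mem_filter.1 hi).2.le) K)
    _ = ENNReal.ofReal (L * (n * collProb d M W w R₂ ^ K)) := by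
        rw [ENNReal.ofReal_mul (Nat.cast_nonneg _), ENNReal.ofReal_mul (Nat.cast_nonneg _)]
        simp
    _ ≤ ENNReal.ofReal ε * T := by
        rw [← ENNReal.ofReal_natCast T, ← ENNReal.ofReal_mul hε]
        exact ENNReal.ofReal_le_ofReal h

theorem seedLaw_not_isNNSAnswer_le {W : ℝ} (hW : 0 < W) {c : ℕ → ℝ} (hc : LinearIndependent ℚ c)
    (w : Fin d → ℝ) {R₁ R₂ : ℝ} (hR : R₁ ≤ R₂) (D : Fin n → Point d M) (q : Point d M)
    {T : ℕ} (hT : 0 < T) {δ : ℝ} (hδ : 0 ≤ δ)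
    (h₁ : (1 - collProb d M W w R₁ ^ K) ^ L ≤ δ / 2)
    (h₂ : L * (n * collProb d M W w R₂ ^ K) ≤ δ / 2 * T) :
    seedLaw d M K L W {ω | ¬ IsNNSAnswer (wdist w) R₁ R₂ D q
      (query (build W c T ω D) w q R₂).val} ≤ ENNReal.ofReal δ := by
  classical
  by_cases hnear : ∃ i, wdist w (D i) q ≤ R₁
  · obtain ⟨i, hi⟩ := hnear
    have hfar := seedLaw_le_card_far (K := K) (L := L) hW w R₂ D q hT (by positivity) h₂
    have hmiss : seedLaw d M K L W {ω | ∀ j, (fun k => ω (j, k)) ∉ sameBucket K W w (D i) q}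
        ≤ ENNReal.ofReal (δ / 2) := by
      rw [seedLaw_forall_row_notMem_sameBucket hW]
      refine ENNReal.ofReal_le_ofReal (le_trans (pow_le_pow_left₀ (sub_nonneg.2
        (pow_le_one₀ (collProb_pos hW w _).le (collProb_le_one hW w _))) ?_ L) h₁)
      exact sub_le_sub_left (pow_le_pow_left₀ (collProb_pos hW w _).le (collProb_anti hW w hi) K) 1
    rw [← add_halves δ, ENNReal.ofReal_add (by positivity) (by positivity)]
    refine (measure_mono fun ω hω => ?_).trans
      ((measure_union_le _ _).trans (add_le_add hfar hmiss))
    by_contra hgood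
    rw [Set.mem_union, not_or, Set.mem_ofPred_eq, Set.mem_ofPred_eq, not_le] at hgood
    obtain ⟨hg, hg'⟩ := hgood
    obtain ⟨j, hj⟩ := not_forall.1 hg'
    refine hω (isNNSAnswer_query_build W hc T ω D w q R₁ R₂ hR hg ⟨i, j, hi, fun k => ?_⟩)
    exact Set.mem_univ_pi.1 (not_not.1 hj) k
  · have : {ω : Seed d M K L | ¬ IsNNSAnswer (wdist w) R₁ R₂ D q
        (query (build W c T ω D) w q R₂).val} = ∅ :=
      Set.eq_empty_of_forall_notMem fun ω hω => hω fun h => absurd h hnear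
    rw [this, measure_empty]
    exact zero_le

/-! ### Choice of the parameters -/

theorem exists_linearIndependent_rat : ∃ c : ℕ → ℝ, LinearIndependent ℚ c := by
  have : Infinite (Module.Basis.ofVectorSpaceIndex ℚ ℝ) := by
    rw [Cardinal.infinite_iff, (Module.Basis.ofVectorSpace ℚ ℝ).mk_eq_rank'',
      Real.rank_rat_real]
    exact Cardinal.aleph0_le_continuum
  exact ⟨_, (Module.Basis.ofVectorSpace ℚ ℝ).linearIndependent.comp _
    (Infinite.natEmbedding _).injective⟩

/-- The number of hash functions per table: far points collide with probability at most `1 / n`. -/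
def numHashes (p₂ : ℝ) (n : ℕ) : ℕ := ⌈Real.log n / -Real.log p₂⌉₊

/-- The number of tables: a near point is missed by all of them with probability at most `δ / 2`. -/
def numTables (δ p₁ p₂ : ℝ) (n : ℕ) : ℕ := ⌈Real.log (2 / δ) / p₁ ^ numHashes p₂ n⌉₊

/-- The number of candidates after which a query gives up: `2 / δ` times the bound `numTables` on
the mean number of far candidates. -/
def maxCandidates (δ p₁ p₂ : ℝ) (n : ℕ) : ℕ := ⌈2 * numTables δ p₁ p₂ n / δ⌉₊

theorem log_two_div_pos {δ : ℝ} (hδ₀ : 0 < δ) (hδ₁ : δ < 1) : 0 < Real.log (2 / δ) :=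
  Real.log_pos (by rw [lt_div_iff₀ hδ₀]; linarith)

theorem numTables_pos {δ p₁ : ℝ} (hδ₀ : 0 < δ) (hδ₁ : δ < 1) (hp₁ : 0 < p₁) (p₂ : ℝ) (n : ℕ) :
    0 < numTables δ p₁ p₂ n :=
  Nat.ceil_pos.2 (div_pos (log_two_div_pos hδ₀ hδ₁) (pow_pos hp₁ _))

theorem maxCandidates_pos {δ p₁ : ℝ} (hδ₀ : 0 < δ) (hδ₁ : δ < 1) (hp₁ : 0 < p₁) (p₂ : ℝ)
    (n : ℕ) : 0 < maxCandidates δ p₁ p₂ n := by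
  have := numTables_pos hδ₀ hδ₁ hp₁ p₂ n
  exact Nat.ceil_pos.2 (by positivity)

theorem natCast_mul_pow_numHashes_le {p₂ : ℝ} (h₀ : 0 < p₂) (h₁ : p₂ < 1) {n : ℕ} (hn : 0 < n) :
    n * p₂ ^ numHashes p₂ n ≤ 1 := by
  have hl : 0 < -Real.log p₂ := neg_pos.2 (Real.log_neg h₀ h₁)
  have hK := Nat.le_ceil (Real.log n / -Real.log p₂)
  rw [div_le_iff₀ hl] at hK
  have hn' : (0 : ℝ) < n := by exact_mod_cast hn
  rw [← Real.log_nonpos_iff (by positivity), Real.log_mul hn'.ne' (by positivity), Real.log_pow]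
  unfold numHashes
  linarith

theorem one_sub_pow_numTables_le {δ p₁ : ℝ} (hδ₀ : 0 < δ) (hp₁ : 0 < p₁) (hp₁' : p₁ ≤ 1) (p₂ : ℝ)
    (n : ℕ) : (1 - p₁ ^ numHashes p₂ n) ^ numTables δ p₁ p₂ n ≤ δ / 2 := by
  have hpos : 0 < p₁ ^ numHashes p₂ n := pow_pos hp₁ _
  have hL := Nat.le_ceil (Real.log (2 / δ) / p₁ ^ numHashes p₂ n)
  rw [div_le_iff₀ hpos] at hL
  calc (1 - p₁ ^ numHashes p₂ n) ^ numTables δ p₁ p₂ n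
      ≤ Real.exp (-p₁ ^ numHashes p₂ n) ^ numTables δ p₁ p₂ n :=
        pow_le_pow_left₀ (sub_nonneg.2 (pow_le_one₀ hp₁.le hp₁')) (Real.one_sub_le_exp_neg _) _
    _ = Real.exp (-(numTables δ p₁ p₂ n * p₁ ^ numHashes p₂ n)) := by
        rw [← Real.exp_nat_mul, mul_neg]
    _ ≤ Real.exp (-Real.log (2 / δ)) := Real.exp_le_exp.2 (neg_le_neg hL)
    _ = δ / 2 := by rw [← Real.log_inv, Real.exp_log (by positivity), inv_div]

theorem numTables_mul_le {δ p₁ p₂ : ℝ} (hδ₀ : 0 < δ) (h₀ : 0 < p₂) (h₁ : p₂ < 1)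
    {n : ℕ} (hn : 0 < n) :
    numTables δ p₁ p₂ n * (n * p₂ ^ numHashes p₂ n) ≤ δ / 2 * maxCandidates δ p₁ p₂ n := by
  have hT := Nat.le_ceil (2 * (numTables δ p₁ p₂ n : ℝ) / δ)
  rw [div_le_iff₀ hδ₀] at hT
  have := mul_le_mul_of_nonneg_left (natCast_mul_pow_numHashes_le h₀ h₁ hn)
    (Nat.cast_nonneg (α := ℝ) (numTables δ p₁ p₂ n))
  unfold maxCandidates
  linarith

theorem numHashes_le {p₂ : ℝ} (h₀ : 0 < p₂) (h₁ : p₂ < 1) {n : ℕ} (hn : 2 ≤ n) :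
    (numHashes p₂ n : ℝ) ≤ (1 / -Real.log p₂ + 1 / Real.log 2) * Real.log n := by
  have hl : 0 < -Real.log p₂ := neg_pos.2 (Real.log_neg h₀ h₁)
  have hl2 : 0 < Real.log 2 := Real.log_pos one_lt_two
  have hn' : Real.log 2 ≤ Real.log n := Real.log_le_log two_pos (by exact_mod_cast hn)
  have hln : 0 < Real.log n := hl2.trans_le hn'
  refine (Nat.ceil_lt_add_one (by positivity)).le.trans ?_
  have : 1 ≤ Real.log n / Real.log 2 := (one_le_div hl2).2 hn'
  rw [add_mul, one_div_mul_eq_div, one_div_mul_eq_div]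
  linarith

/-- Rounding the number of hash functions up costs at most one more factor `p₁`. -/
theorem numTables_le {δ p₁ p₂ : ℝ} (hδ₀ : 0 < δ) (hδ₁ : δ < 1) (h₀ : 0 < p₂) (h₁ : p₂ < 1)
    (hp₁ : 0 < p₁) (hp₁' : p₁ ≤ 1) {n : ℕ} (hn : 1 ≤ n) :
    (numTables δ p₁ p₂ n : ℝ)
      ≤ (Real.log (2 / δ) / p₁ + 1) * (n : ℝ) ^ (Real.log p₁ / Real.log p₂) := by
  have hn' : (1 : ℝ) ≤ n := by exact_mod_cast hn
  have hl : Real.log p₂ < 0 := Real.log_neg h₀ h₁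
  have hl₁ : Real.log p₁ ≤ 0 := Real.log_nonpos hp₁.le hp₁'
  have hK := (Nat.ceil_lt_add_one
    (div_nonneg (Real.log_nonneg hn') (neg_pos.2 hl).le)).le
  have hpow : (n : ℝ) ^ (-(Real.log p₁ / Real.log p₂)) * p₁ ≤ p₁ ^ numHashes p₂ n := by
    rw [Real.rpow_def_of_pos (by linarith), ← Real.exp_log (pow_pos hp₁ (numHashes p₂ n)),
      Real.log_pow]
    nth_rewrite 2 [← Real.exp_log hp₁]
    rw [← Real.exp_add, Real.exp_le_exp]
    have := mul_le_mul_of_nonpos_right hK hl₁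
    refine le_trans (le_of_eq ?_) this
    field_simp
  have hN : 1 ≤ (n : ℝ) ^ (Real.log p₁ / Real.log p₂) :=
    Real.one_le_rpow hn' (div_nonneg_of_nonpos hl₁ hl.le)
  have hδ := log_two_div_pos hδ₀ hδ₁
  refine (Nat.ceil_lt_add_one (by positivity)).le.trans ?_
  have : Real.log (2 / δ) / p₁ ^ numHashes p₂ n
      ≤ Real.log (2 / δ) / p₁ * (n : ℝ) ^ (Real.log p₁ / Real.log p₂) := by
    refine (div_le_div_of_nonneg_left hδ.le (by positivity) hpow).trans_eq ?_
    rw [Real.rpow_neg (by linarith)]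
    field_simp
  linarith

theorem maxCandidates_le {δ p₁ p₂ B N : ℝ} (hδ₀ : 0 < δ) {n : ℕ} (hN : 1 ≤ N)
    (hB : numTables δ p₁ p₂ n ≤ B * N) :
    (maxCandidates δ p₁ p₂ n : ℝ) ≤ (2 * B / δ + 1) * N := by
  refine (Nat.ceil_lt_add_one (by positivity)).le.trans ?_
  have : 2 * (numTables δ p₁ p₂ n : ℝ) / δ ≤ 2 * (B * N) / δ := by gcongr
  rw [show (2 * B / δ + 1) * N = 2 * (B * N) / δ + N by ring]
  linarith

/-! ### Time and space -/

theorem steps_bound {d K L T m : ℕ} (hd : 1 ≤ d) {a b B B' l N : ℝ} (ha : 0 ≤ a) (hb : 0 ≤ b)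
    (hl : 1 ≤ b * l) (hl₀ : 0 ≤ l) (hN : 1 ≤ N) (hK : K ≤ a * l) (hm : m ≤ 2 * b * l)
    (hL : L ≤ B * N) (hT : T ≤ B' * N) :
    ((((8 * d + 10) * K + 6 * m + 9) * L + (8 * d + 9) * T + 2 : ℕ) : ℝ)
      ≤ ((18 * a + 21 * b) * B + 17 * B' * b + 2 * b) * (N * d * l) := by
  have hd' : (1 : ℝ) ≤ d := by exact_mod_cast hd
  push_cast
  have h1 : (8 * d + 10) * (K : ℝ) + 6 * m + 9 ≤ (18 * a + 21 * b) * (d * l) := by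
    have e1 : (8 * d + 10) * (K : ℝ) ≤ (18 * d) * (a * l) := by gcongr; linarith
    have e2 : 12 * (b * l) + 9 ≤ 21 * (d * (b * l)) := by nlinarith
    linarith
  have h2 : ((8 * d + 10) * (K : ℝ) + 6 * m + 9) * L
      ≤ (18 * a + 21 * b) * (d * l) * (B * N) := by
    gcongr
  have h3 : (8 * d + 9) * (T : ℝ) ≤ 17 * d * (B' * N * (b * l)) := by
    have hBN : 0 ≤ B' * N := (Nat.cast_nonneg T).trans hT
    have : (T : ℝ) ≤ B' * N * (b * l) := hT.trans (le_mul_of_one_le_right hBN hl)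
    gcongr
    linarith
  have h4 : 1 ≤ N * d * (b * l) := one_le_mul_of_one_le_of_one_le
    (one_le_mul_of_one_le_of_one_le hN hd') hl
  linarith

theorem totalSpace_le {n d M K L : ℕ} (hn : 1 ≤ n) (hd : 1 ≤ d) (hM : 1 ≤ M) {a B N : ℝ}
    (ha : 0 ≤ a) (hN : 1 ≤ N) (hK : K ≤ a * n) (hL : L ≤ B * N) :
    (totalSpace n d M K L : ℝ) ≤ (7 + a + 5 * B * a + 2 * B) * (d * M) * (n * N) := by
  have hd' : (1 : ℝ) ≤ d := by exact_mod_cast hd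
  have hM' : (1 : ℝ) ≤ M := by exact_mod_cast hM
  have hn' : (1 : ℝ) ≤ n := by exact_mod_cast hn
  have hdM : 1 ≤ (d : ℝ) * M := one_le_mul_of_one_le_of_one_le hd' hM'
  have hBN : 0 ≤ B * N := (Nat.cast_nonneg L).trans hL
  have hB : 0 ≤ B := nonneg_of_mul_nonneg_left hBN (by linarith)
  have hLK : (L : ℝ) * K ≤ B * N * (a * n) := by gcongr
  have hdn : (d : ℝ) * M * (n * N) ≥ 1 := one_le_mul_of_one_le_of_one_le hdM
    (one_le_mul_of_one_le_of_one_le hn' hN)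
  unfold totalSpace tableSpace
  push_cast
  have e1 : (K : ℝ) ≤ a * (d * M * (n * N)) := hK.trans (by
    gcongr
    rw [show (d : ℝ) * M * (n * N) = n * (d * M * N) by ring]
    exact le_mul_of_one_le_right (by linarith) (one_le_mul_of_one_le_of_one_le hdM hN))
  have e2 : (n : ℝ) * d ≤ d * M * (n * N) := by
    rw [show (d : ℝ) * M * (n * N) = n * d * (M * N) by ring]
    exact le_mul_of_one_le_right (by positivity) (one_le_mul_of_one_le_of_one_le hM' hN)
  have e3 : 2 * ((L : ℝ) * K * d * (M + 1)) ≤ 4 * B * a * (d * M * (n * N)) := by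
    calc 2 * ((L : ℝ) * K * d * (M + 1)) ≤ 2 * (B * N * (a * n) * d * (M + M)) := by gcongr
      _ = _ := by ring
  have e4 : (L : ℝ) * K ≤ B * a * (d * M * (n * N)) := by
    refine hLK.trans ?_
    rw [show B * N * (a * n) = B * a * (1 * (n * N)) by ring]
    gcongr
  have e5 : 2 * ((L : ℝ) * n) ≤ 2 * B * (d * M * (n * N)) := by
    calc 2 * ((L : ℝ) * n) ≤ 2 * (B * N * n) := by gcongr
      _ = 2 * B * (1 * (n * N)) := by ring
      _ ≤ _ := by gcongr
  linarith

end ALSH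

end

theorem theorem4 (δ : ℝ) (hδ₀ : 0 < δ) (hδ₁ : δ < 1) :
    ∃ (c : ℕ → ℝ) (K L T : ℝ → ℝ → ℕ → ℕ) (C : ℝ → ℝ → ℝ),
      LinearIndependent ℚ c ∧
      ∀ (d M : ℕ) (W : ℝ) (w : Fin d → ℝ) (R₁ R₂ : ℝ),
        1 ≤ d → 1 ≤ M → 0 < W → R₁ < R₂ → 0 ≤ ALSH.transDistSq d M w R₁ →
        ∀ p₁ p₂ ρ : ℝ, p₁ = ALSH.collProb d M W w R₁ → p₂ = ALSH.collProb d M W w R₂ →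
          ρ = Real.log p₁ / Real.log p₂ →
          (0 < p₂ ∧ p₂ < p₁ ∧ p₁ ≤ 1) ∧ ρ < 1 ∧
          ∀ n : ℕ, 2 ≤ n →
            -- every query is answered correctly with probability at least `1 - δ`
            (∀ (D : Fin n → ALSH.Point d M) (q : ALSH.Point d M),
              ALSH.seedLaw d M (K p₁ p₂ n) (L p₁ p₂ n) W
                {ω | ¬ ALSH.IsNNSAnswer (ALSH.wdist w) R₁ R₂ D q
                  (ALSH.query (ALSH.build W c (T p₁ p₂ n) ω D) w q R₂).val} ≤ ENNReal.ofReal δ) ∧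
            -- query time, for all random choices
            (∀ (ω : ALSH.Seed d M (K p₁ p₂ n) (L p₁ p₂ n)) (D : Fin n → ALSH.Point d M)
              (q : ALSH.Point d M),
              ((ALSH.query (ALSH.build W c (T p₁ p₂ n) ω D) w q R₂).steps : ℝ)
                ≤ C p₁ p₂ * ((n : ℝ) ^ ρ * d * Real.log n)) ∧
            -- space of the tables, and of everything that is stored
            (ALSH.tableSpace n (L p₁ p₂ n) : ℝ) ≤ C p₁ p₂ * (n : ℝ) ^ (1 + ρ) ∧
            (ALSH.totalSpace n d M (K p₁ p₂ n) (L p₁ p₂ n) : ℝ)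
              ≤ C p₁ p₂ * (d * M) * (n : ℝ) ^ (1 + ρ) := by
  obtain ⟨c, hc⟩ := ALSH.exists_linearIndependent_rat
  let a : ℝ → ℝ := fun p₂ => 1 / -Real.log p₂ + 1 / Real.log 2
  let b : ℝ := 1 / Real.log 2
  let B : ℝ → ℝ := fun p₁ => Real.log (2 / δ) / p₁ + 1
  refine ⟨c, fun _ p₂ n => ALSH.numHashes p₂ n, ALSH.numTables δ, ALSH.maxCandidates δ,
    fun p₁ p₂ => ((18 * a p₂ + 21 * b) * B p₁ + 17 * (2 * B p₁ / δ + 1) * b + 2 * b)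
      + (7 + a p₂ + 5 * B p₁ * a p₂ + 2 * B p₁), hc, ?_⟩
  intro d M W w R₁ R₂ hd hM hW hR hR₁ p₁ p₂ ρ e₁ e₂ eρ
  have h₀ : 0 < p₂ := e₂ ▸ ALSH.collProb_pos hW w R₂
  have h₂₁ : p₂ < p₁ := e₁ ▸ e₂ ▸ ALSH.collProb_lt hW w hR hR₁
  have hp₁' : p₁ ≤ 1 := e₁ ▸ ALSH.collProb_le_one hW w R₁
  have hp₁ : 0 < p₁ := h₀.trans h₂₁
  have h₁ : p₂ < 1 := h₂₁.trans_le hp₁'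
  have hlog : Real.log p₂ < 0 := Real.log_neg h₀ h₁
  have hρ₀ : 0 ≤ ρ := eρ ▸ div_nonneg_of_nonpos (Real.log_nonpos hp₁.le hp₁') hlog.le
  refine ⟨⟨h₀, h₂₁, hp₁'⟩, ?_, fun n hn => ?_⟩
  · rw [eρ, div_lt_one_of_neg hlog]
    exact Real.log_lt_log h₀ h₂₁
  have hn1 : 1 ≤ n := by omega
  have hn' : (1 : ℝ) ≤ n := by exact_mod_cast hn1
  have hl2 : 0 < Real.log 2 := Real.log_pos one_lt_two
  have hln : Real.log 2 ≤ Real.log n := Real.log_le_log two_pos (by exact_mod_cast hn)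
  have hb : 0 < b := one_div_pos.2 hl2
  have ha : 0 < a p₂ := add_pos (one_div_pos.2 (neg_pos.2 hlog)) hb
  have hB : 0 < B p₁ := by
    have := ALSH.log_two_div_pos hδ₀ hδ₁
    positivity
  have hN : 1 ≤ (n : ℝ) ^ ρ := Real.one_le_rpow hn' hρ₀
  have hK := ALSH.numHashes_le h₀ h₁ hn
  have hL : (ALSH.numTables δ p₁ p₂ n : ℝ) ≤ B p₁ * (n : ℝ) ^ ρ :=
    eρ ▸ ALSH.numTables_le hδ₀ hδ₁ h₀ h₁ hp₁ hp₁' hn1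
  have hpow : (n : ℝ) ^ (1 + ρ) = n * (n : ℝ) ^ ρ := by
    rw [Real.rpow_add (by linarith), Real.rpow_one]
  have hbl : 1 ≤ b * Real.log n := by
    rw [one_div_mul_eq_div]
    exact (one_le_div hl2).2 hln
  have hC₁ : 0 ≤ (18 * a p₂ + 21 * b) * B p₁ + 17 * (2 * B p₁ / δ + 1) * b + 2 * b := by
    positivity
  have hC₂ : 0 ≤ 7 + a p₂ + 5 * B p₁ * a p₂ + 2 * B p₁ := by positivity
  refine ⟨fun D q => ?_, fun ω D q => ?_, ?_, ?_⟩
  · refine ALSH.seedLaw_not_isNNSAnswer_le hW hc w hR.le D q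
      (ALSH.maxCandidates_pos hδ₀ hδ₁ hp₁ p₂ n) hδ₀.le ?_ ?_
    · rw [← e₁]
      exact ALSH.one_sub_pow_numTables_le hδ₀ hp₁ hp₁' p₂ n
    · rw [← e₂]
      exact ALSH.numTables_mul_le hδ₀ h₀ h₁ hn1
  · have hm : ((Nat.log 2 n + 1 : ℕ) : ℝ) ≤ 2 * b * Real.log n := by
      have := Real.natLog_le_logb n 2
      rw [Real.logb, Nat.cast_ofNat, ← one_div_mul_eq_div] at this
      push_cast
      linarith
    have hsteps := ALSH.query_steps_le
      (ALSH.build W c (ALSH.maxCandidates δ p₁ p₂ n) ω D) w q R₂ (Nat.log 2 n + 1)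
      (Nat.lt_pow_succ_log_self one_lt_two n)
    refine (Nat.cast_le.2 hsteps).trans ((ALSH.steps_bound hd ha.le hb.le hbl
      (hl2.le.trans hln) hN hK hm hL (ALSH.maxCandidates_le hδ₀ hN hL)).trans ?_)
    have : 0 ≤ (n : ℝ) ^ ρ * d * Real.log n :=
      mul_nonneg (by positivity) (hl2.le.trans hln)
    exact mul_le_mul_of_nonneg_right (le_add_of_nonneg_right hC₂) this
  · rw [hpow, ALSH.tableSpace]
    push_cast
    calc 2 * ((ALSH.numTables δ p₁ p₂ n : ℝ) * n) ≤ 2 * (B p₁ * (n : ℝ) ^ ρ * n) := by gcongr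
      _ = 2 * B p₁ * (n * (n : ℝ) ^ ρ) := by ring
      _ ≤ _ := by
        refine mul_le_mul_of_nonneg_right ?_ (by positivity)
        have : 0 ≤ 5 * B p₁ * a p₂ := by positivity
        linarith
  · rw [hpow]
    refine (ALSH.totalSpace_le hn1 hd hM ha.le hN (hK.trans (mul_le_mul_of_nonneg_left
      ((Real.log_le_sub_one_of_pos (by linarith)).trans (sub_le_self _ zero_le_one)) ha.le))
      hL).trans ?_
    gcongr
    exact le_add_of_nonneg_left hC₁
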